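/- Let $k \ge 0$ and let $\mathbf{w} = (w_1,\dots,w_k)$, where each $w_i$ is a (possibly empty) positive word in the letters $a_1,\dots,a_{i-1}$. Let $$G_k(\mathbf{w}) = \langle a_1,\dots,a_k,t \mid t^{-1}a_i t = a_i w_i,\ 1 \le i \le k\rangle,$$ and let $H_k = \langle a_1t,\dots,a_kt\rangle \le G_k(\mathbf{w})$. A subgroup $H$ of a group $G$ is called separable if for every $g \in G\setminus H$ there is a homomorphism $\phi$ from $G$ onto a finite group with $\phi(g)\notin\phi(H)$. Then $H_k$ is separable in $G_k(\mathbf{w})$ if and only if $\mathbf{w} = (1,\dots,1)$, i.e. every $w_i$ is the empty word. Consequently, if the HNN extension $$\Gamma_k(\mathbf{w}) = \langle G_k(\mathbf{w}), p \mid p^{-1}hp = h \text{ for all } h \in H_k\rangle$$ is residually finite, then $G_k(\mathbf{w}) = F_k\times\mathbb{Z}$, i.e. there is an isomorphism from $G_k(\mathbf{w})$ onto $F_k\times\mathbb{Z}$, with $F_k$ free of rank $k$, that sends $a_1,\dots,a_k$ to a free basis of the factor $F_k$ and $t$ to a generator of the factor $\mathbb{Z}$. -/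

import Mathlib

/-- A subgroup `H` of `G` is separable if every `g ∉ H` can be separated from `H` in a finite
quotient of `G`: there is a normal subgroup `N` of finite index such that the image of `g` in
`G ⧸ N` does not lie in the image of `H`. -/
def IsSeparableSubgroup {G : Type*} [Group G] (H : Subgroup G) : Prop :=
  ∀ g : G, g ∉ H → ∃ (N : Subgroup G) (_ : N.Normal), N.FiniteIndex ∧
    QuotientGroup.mk' N g ∉ H.map (QuotientGroup.mk' N)

namespace Hydra

/-- The generating symbols `a_1, …, a_k, t`. The index set `{1, …, k}` is modelled by `Fin k`. -/
inductive Gen (k : ℕ) : Type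
  | a (i : Fin k) : Gen k
  | t : Gen k

/-- The element of the free group on `a_1, …, a_k, t` spelled by a positive word in the `a_i`.
A positive word is a list of indices; the empty list is the trivial word `1`. -/
def wordElt {k : ℕ} (u : List (Fin k)) : FreeGroup (Gen k) :=
  (u.map fun j => FreeGroup.of (Gen.a j)).prod

/-- The relators `(t⁻¹ a_i t) (a_i w_i)⁻¹`. -/
def rels {k : ℕ} (w : Fin k → List (Fin k)) : Set (FreeGroup (Gen k)) :=
  Set.range fun i : Fin k =>
    ((FreeGroup.of Gen.t)⁻¹ * FreeGroup.of (Gen.a i) * FreeGroup.of Gen.t) *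
      (FreeGroup.of (Gen.a i) * wordElt (w i))⁻¹

/-- The group `G_k(w) = ⟨a_1, …, a_k, t | t⁻¹ a_i t = a_i w_i, 1 ≤ i ≤ k⟩`. -/
abbrev G {k : ℕ} (w : Fin k → List (Fin k)) : Type :=
  PresentedGroup (rels w)

/-- The generator `a_i` of `G_k(w)`. -/
def genA {k : ℕ} (w : Fin k → List (Fin k)) (i : Fin k) : G w :=
  PresentedGroup.of (Gen.a i)

/-- The generator `t` of `G_k(w)`. -/
def genT {k : ℕ} (w : Fin k → List (Fin k)) : G w :=
  PresentedGroup.of Gen.t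

/-- The subgroup `H_k = ⟨a_1 t, …, a_k t⟩` of `G_k(w)`. -/
def H {k : ℕ} (w : Fin k → List (Fin k)) : Subgroup (G w) :=
  Subgroup.closure (Set.range fun i : Fin k => genA w i * genT w)

/-- The HNN extension `Γ_k(w) = ⟨G_k(w), p | p⁻¹ h p = h, h ∈ H_k⟩`. -/
abbrev Gam {k : ℕ} (w : Fin k → List (Fin k)) : Type :=
  HNNExtension (G w) (H w) (H w) (MulEquiv.refl (H w))

end Hydra

/-!
Put `s_i = a_i t`, so that `H` is generated by the `s_i` and the relation for `a_i` reads
`s_i⁻¹ t s_i = w_i⁻¹ t`.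

If all `w_i` are empty, then `t` is central and `H` is the kernel of the homomorphism onto `ℤ` with
`a_i ↦ -1` and `t ↦ 1`; so `H` is separable, and the presentation is that of `F_k × ℤ`.

Otherwise let `i` be minimal with `w_i` nonempty, let `n` be the length of `w_i`, let `j` be a letter
of `w_i`, and consider `g = (t s_i⁻¹) s_j (t s_i⁻¹)⁻¹`. The letters of `w_i` commute with `t`, so
`v = w_i t ^ n` lies in `H` and commutes with `t`, and `s_i⁻¹ t s_i = t ^ (n + 1) v⁻¹`. Modulo a
subgroup `K ≥ H` of finite index, right multiplication by `s_i` thus permutes the cosets `K t ^ m`.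
So `K t s_i⁻¹` is one of these cosets, all of which `s_j` fixes, and `g ∈ K`
(`Subgroup.conj_mem_of_finiteIndex`).

That `g ∉ H` is shown in a tower of HNN extensions whose stable letters are the `s_l⁻¹`
(`Hydra.IsModel.exists_succ`), to which `G_k(w)` maps. By Britton's lemma, `⟨H₀, s_l⟩` meets the
base in `H₀` whenever `H₀` meets both associated subgroups `⟨t⟩` and `⟨w_l⁻¹ t⟩` trivially. This
condition is kept along the tower by a positivity argument: `t` and the `a_i⁻¹` lie in a subsemigroup
`N` disjoint from the subgroup generated by the `s_i` (`HNNExtension.of_mul_notMem_closure`), and the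
generators of the associated subgroups lie in `N`.

If the HNN extension `Γ_k(w)` is residually finite, then `H` is separable, because by Britton's lemma
`H` consists of the elements of `G_k(w)` that commute with the stable letter
(`isSeparableSubgroup_of_residuallyFinite_hnnExtension`).
-/

/-! ### Reduced words in HNN extensions -/

namespace HNNExtension

open NormalWord

section

variable {G : Type*} [Group G] {A B : Subgroup G} {φ : A ≃* B}

/-- If a subgroup `H₀` of the base meets both associated subgroups trivially, a product of elements
of `H₀` and powers of the stable letter can only be shortened by cancelling the stable letter
against its inverse. So every element of `⟨H₀, t⟩` is the product of a reduced word with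
coefficients in `H₀`. -/
theorem exists_reducedWord_of_mem_closure {H₀ : Subgroup G}
    (hH₀ : ∀ u : ℤˣ, ∀ x ∈ H₀, x ∈ toSubgroup A B u → x = 1)
    {x : HNNExtension G A B φ} (hx : x ∈ Subgroup.closure (of '' (H₀ : Set G) ∪ {t})) :
    ∃ v : ReducedWord G A B, v.prod φ = x ∧ v.head ∈ H₀ ∧ ∀ p ∈ v.toList, p.2 ∈ H₀ := by
  have key : ∀ (u : ℤˣ) (y : HNNExtension G A B φ),
      (∃ v : ReducedWord G A B, v.prod φ = y ∧ v.head ∈ H₀ ∧ ∀ p ∈ v.toList, p.2 ∈ H₀) →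
      ∃ v : ReducedWord G A B, v.prod φ = t ^ (u : ℤ) * y ∧ v.head ∈ H₀ ∧
        ∀ p ∈ v.toList, p.2 ∈ H₀ := by
    rintro u y ⟨⟨g, l, hc⟩, rfl, hg, hl⟩
    by_cases h : ∀ p ∈ l.head?, g ∈ toSubgroup A B u → u = p.1
    · exact ⟨⟨1, (u, g) :: l, List.isChain_cons.2 ⟨h, hc⟩⟩, by simp [ReducedWord.prod, mul_assoc],
        H₀.one_mem, by simpa [hg] using hl⟩
    · push Not at h
      obtain ⟨⟨u', g'⟩, hp, hgu, hne⟩ := h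
      -- A cancellation is only possible at the trivial coefficient.
      obtain rfl := hH₀ u g hg hgu
      obtain ⟨l', rfl⟩ : ∃ l', l = (u', g') :: l' := by
        cases l with
        | nil => simp at hp
        | cons q l' => exact ⟨l', by simp at hp; rw [hp]⟩
      have hu : u' = -u := by
        rcases Int.units_eq_one_or u with rfl | rfl <;>
          rcases Int.units_eq_one_or u' with rfl | rfl <;> simp_all
      subst hu
      refine ⟨⟨g', l', (List.isChain_cons.1 hc).2⟩, ?_, hl (-u, g') (by simp),
        fun p hp => hl p (by simp [hp])⟩
      simp [ReducedWord.prod, mul_assoc]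
  induction hx using Subgroup.closure_induction_left with
  | one => exact ⟨ReducedWord.empty G A B, by simp [ReducedWord.prod], H₀.one_mem, by simp⟩
  | mul_left x hx y _ ih =>
    rcases hx with ⟨g, hg, rfl⟩ | rfl
    · obtain ⟨v, rfl, h1, h2⟩ := ih
      exact ⟨⟨g * v.head, v.toList, v.chain⟩, by simp [ReducedWord.prod, mul_assoc],
        H₀.mul_mem hg h1, h2⟩
    · simpa using key 1 y ih
  | inv_mul_cancel x hx y _ ih =>
    rcases hx with ⟨g, hg, rfl⟩ | rfl
    · obtain ⟨v, rfl, h1, h2⟩ := ih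
      exact ⟨⟨g⁻¹ * v.head, v.toList, v.chain⟩, by simp [ReducedWord.prod, mul_assoc],
        H₀.mul_mem (H₀.inv_mem hg) h1, h2⟩
    · simpa using key (-1) y ih

theorem mem_of_of_mem_closure {H₀ : Subgroup G}
    (hH₀ : ∀ u : ℤˣ, ∀ x ∈ H₀, x ∈ toSubgroup A B u → x = 1) {b : G}
    (hb : (of b : HNNExtension G A B φ) ∈ Subgroup.closure (of '' (H₀ : Set G) ∪ {t})) :
    b ∈ H₀ := by
  obtain ⟨v, hv, h1, -⟩ := exists_reducedWord_of_mem_closure hH₀ hb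
  have h2 := HNNExtension.ReducedWord.toList_eq_nil_of_mem_of_range φ v ⟨b, hv.symm⟩
  have h3 : (of v.head : HNNExtension G A B φ) = of b := by
    rw [← hv]; simp [ReducedWord.prod, h2]
  rwa [← of_injective φ h3]

/-- If the product of a reduced word lies in `⟨H₀, t⟩`, then the part of the word before the first
stable letter lies in `H₀` modulo an associated subgroup. -/
theorem exists_head_inv_mul_mem_of_prod_mem_closure {H₀ : Subgroup G}
    (hH₀ : ∀ u : ℤˣ, ∀ x ∈ H₀, x ∈ toSubgroup A B u → x = 1) {v : ReducedWord G A B}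
    (hv : v.prod φ ∈ Subgroup.closure (of '' (H₀ : Set G) ∪ {t}))
    {u : ℤˣ} (hu : u ∈ v.toList.head?.map Prod.fst) :
    ∃ h ∈ H₀, v.head⁻¹ * h ∈ toSubgroup A B (-u) := by
  obtain ⟨v', hv', h1, -⟩ := exists_reducedWord_of_mem_closure hH₀ hv
  exact ⟨v'.head, h1, (HNNExtension.ReducedWord.map_fst_eq_and_of_prod_eq φ hv'.symm).2 u hu⟩

/-- A product of base elements and positive powers of the stable letter is reduced as it stands. -/
theorem exists_reducedWord_fst_eq_one {x : HNNExtension G A B φ}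
    (hx : x ∈ Submonoid.closure (Set.range of ∪ {t})) :
    ∃ v : ReducedWord G A B, v.prod φ = x ∧ ∀ p ∈ v.toList, p.1 = 1 := by
  induction hx using Submonoid.closure_induction_left with
  | one => exact ⟨ReducedWord.empty G A B, by simp [ReducedWord.prod], by simp⟩
  | mul_left x hx y _ ih =>
    obtain ⟨v, rfl, h⟩ := ih
    rcases hx with ⟨g, rfl⟩ | rfl
    · exact ⟨⟨g * v.head, v.toList, v.chain⟩, by simp [ReducedWord.prod, mul_assoc], h⟩
    · refine ⟨⟨1, (1, v.head) :: v.toList, List.isChain_cons.2 ⟨?_, v.chain⟩⟩,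
        by simp [ReducedWord.prod, mul_assoc], by simpa using h⟩
      intro p hp _
      exact (h p (List.mem_of_mem_head? hp)).symm

end

section

variable {G : Type*} [Group G] {a b : G} {φ : Subgroup.zpowers a ≃* Subgroup.zpowers b}

/-- In `⟨G, t | t a t⁻¹ = b⟩`, let `N` be a subsemigroup of `G` that contains `a` and `b` and is
disjoint from a subgroup `H₀`. Then a product of elements of `N` and positive powers of `t` that
starts with an element of `N` is not in `⟨H₀, t⟩`. -/
theorem of_mul_notMem_closure {H₀ : Subgroup G} {N : Subsemigroup G}
    (hφ : (φ ⟨a, Subgroup.mem_zpowers a⟩ : G) = b) (ha : a ∈ N) (hb : b ∈ N)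
    (hN : ∀ x ∈ N, x ∉ H₀)
    (hH₀ : ∀ u : ℤˣ, ∀ x ∈ H₀, x ∈ toSubgroup (Subgroup.zpowers a) (Subgroup.zpowers b) u → x = 1)
    {z : HNNExtension G (Subgroup.zpowers a) (Subgroup.zpowers b) φ}
    (hz : z ∈ Submonoid.closure (of '' (N : Set G) ∪ {t})) {x : G} (hx : x ∈ N) :
    of x * z ∉ Subgroup.closure (of '' (H₀ : Set G) ∪ {t}) := by
  set K : Subgroup (HNNExtension G (Subgroup.zpowers a) (Subgroup.zpowers b) φ) :=
    Subgroup.closure (of '' (H₀ : Set G) ∪ {t}) with hKdef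
  have hK : ∀ h ∈ H₀, (of h : HNNExtension G _ _ φ) ∈ K := fun h hh =>
    Subgroup.subset_closure (Or.inl ⟨h, hh, rfl⟩)
  have htK : (t : HNNExtension G _ _ φ) ∈ K := Subgroup.subset_closure (Or.inr rfl)
  have hpow : ∀ r : ℕ, (of (b ^ r) * t : HNNExtension G _ _ φ) = t * of (a ^ r) := by
    intro r
    have := t_mul_of (φ := φ) (⟨a, Subgroup.mem_zpowers a⟩ ^ r)
    rw [map_pow, Subgroup.coe_pow, Subgroup.coe_pow, hφ] at this
    exact this.symm
  have hpowN : ∀ c ∈ N, ∀ r : ℕ, c ^ (r + 1) ∈ N := by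
    intro c hc r
    induction r with
    | zero => simpa using hc
    | succ r ih => rw [pow_succ]; exact N.mul_mem ih hc
  induction hz using Submonoid.closure_induction_left generalizing x with
  | one =>
    rw [mul_one]
    exact fun h => hN x hx (mem_of_of_mem_closure hH₀ h)
  | mul_left y hy z hz ih =>
    rcases hy with ⟨n, hn, rfl⟩ | rfl
    · rw [← mul_assoc, ← map_mul]
      exact ih (N.mul_mem hx hn)
    · by_cases hxb : ∃ h ∈ H₀, x⁻¹ * h ∈ Subgroup.zpowers b
      · obtain ⟨h, hh, r, hr⟩ := hxb
        have hr' : h = x * b ^ r := by simp only at hr; rw [hr]; group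
        obtain ⟨m, rfl | rfl⟩ := r.eq_nat_or_neg
        · -- `h` would be a product of elements of `N`
          exfalso
          refine hN h ?_ hh
          rw [hr', zpow_natCast]
          cases m with
          | zero => simpa using hx
          | succ m => exact N.mul_mem hx (hpowN b hb m)
        · cases m with
          | zero =>
            refine absurd hh (hN h ?_)
            rw [hr']
            simpa using hx
          | succ m =>
            -- `x` is `h * b ^ (m + 1)`, so `t` moves to the left and turns the power of `b` into
            -- a power of `a`, to which the induction hypothesis applies.
            have hx' : x = h * b ^ (m + 1) := by
              rw [hr', zpow_neg, zpow_natCast]; group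
            have : (of x * (t * z) : HNNExtension G _ _ φ) =
                (of h * t) * (of (a ^ (m + 1)) * z) := by
              rw [hx', map_mul, mul_assoc, ← mul_assoc (of _) t z, hpow]
              simp only [mul_assoc]
            rw [this, K.mul_mem_cancel_left (K.mul_mem (hK h hh) htK)]
            exact ih (hpowN a ha m)
      · intro hmem
        obtain ⟨v, hv, hv1⟩ := exists_reducedWord_fst_eq_one (A := Subgroup.zpowers a)
          (B := Subgroup.zpowers b) (φ := φ) (Submonoid.closure_mono
            (Set.union_subset_union_left _ (Set.image_subset_range _ _)) hz)
        refine hxb (exists_head_inv_mul_mem_of_prod_mem_closure (φ := φ) hH₀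
          (v := ⟨x, (1, v.head) :: v.toList, List.isChain_cons.2
            ⟨fun p hp _ => (hv1 p (List.mem_of_mem_head? hp)).symm, v.chain⟩⟩) (u := 1) ?_ ?_)
        · rw [← hKdef]
          convert hmem using 1
          simp [ReducedWord.prod, mul_assoc, ← hv]
        · simp

end

end HNNExtension

/-! ### Towers of HNN extensions -/

namespace Hydra

/-- A model, in a group `Q`, of the first `l` relations of `G_k(w)`, together with a subgroup `K`
that contains the images of the generators `a_i t` of `H_k` and a subsemigroup `N`, disjoint from
`K`, that contains `t` and the `a_i⁻¹`. The last field singles out elements of `Q` outside `K`. -/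
structure IsModel {k : ℕ} (w : Fin k → List (Fin k)) (l : ℕ) {Q : Type} [Group Q]
    (a : Fin k → Q) (t : Q) (N : Subsemigroup Q) (K : Subgroup Q) : Prop where
  rel : ∀ i : Fin k, i.1 < l → t⁻¹ * a i * t = a i * ((w i).map a).prod
  t_mem : t ∈ N
  inv_mem : ∀ i : Fin k, i.1 < l → (a i)⁻¹ ∈ N
  mul_mem : ∀ i : Fin k, i.1 < l → a i * t ∈ K
  mul_ne_one : ∀ i : Fin k, i.1 < l → a i * t ≠ 1
  disjoint : ∀ x ∈ N, x ∉ K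
  notMem : ∀ i : Fin k, i.1 < l → w i ≠ [] → ∀ j < i,
    (t * (a i * t)⁻¹) * (a j * t) * (t * (a i * t)⁻¹)⁻¹ ∉ K

theorem inv_prod_mem {ι Q : Type*} [Group Q] {N : Subsemigroup Q} {a : ι → Q} {u : List ι}
    (hu : ∀ i ∈ u, (a i)⁻¹ ∈ N) (hne : u ≠ []) : ((u.map a).prod)⁻¹ ∈ N := by
  induction u with
  | nil => exact absurd rfl hne
  | cons i u ih =>
    rw [List.map_cons, List.prod_cons, mul_inv_rev]
    by_cases h : u = []
    · simpa [h] using hu i (by simp)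
    · exact N.mul_mem (ih (fun j hj => hu j (by simp [hj])) h) (hu i (by simp))

theorem zpow_eq_one_of_mem {Q : Type*} [Group Q] {N : Subsemigroup Q} {K : Subgroup Q}
    (hNK : ∀ x ∈ N, x ∉ K) {c : Q} (hc : c ∈ N) {r : ℤ} (hr : c ^ r ∈ K) : r = 0 := by
  have hpow : ∀ m : ℕ, c ^ (m + 1) ∈ N := by
    intro m
    induction m with
    | zero => simpa using hc
    | succ m ih => rw [pow_succ]; exact N.mul_mem ih hc
  obtain ⟨m, rfl | rfl⟩ := r.eq_nat_or_neg <;> cases m with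
  | zero => rfl
  | succ m =>
    refine absurd ?_ (hNK _ (hpow m))
    simpa only [zpow_neg, K.inv_mem_iff, zpow_natCast] using hr

theorem exists_zpowers_mulEquiv {Q : Type*} [Group Q] {a b : Q} (ha : ∀ r : ℤ, a ^ r = 1 → r = 0)
    (hb : ∀ r : ℤ, b ^ r = 1 → r = 0) :
    ∃ φ : Subgroup.zpowers a ≃* Subgroup.zpowers b,
      (φ ⟨a, Subgroup.mem_zpowers a⟩ : Q) = b := by
  have key : ∀ c : Q, (∀ r : ℤ, c ^ r = 1 → r = 0) → ∃ e : Multiplicative ℤ ≃* Subgroup.zpowers c,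
      e (Multiplicative.ofAdd 1) = ⟨c, Subgroup.mem_zpowers c⟩ := by
    intro c hc
    have hbij : Function.Bijective
        (zpowersHom (Subgroup.zpowers c) ⟨c, Subgroup.mem_zpowers c⟩) := by
      refine ⟨?_, ?_⟩
      · rw [injective_iff_map_eq_one]
        intro r hr
        exact Multiplicative.toAdd.injective (hc _ (congrArg Subtype.val hr))
      · rintro ⟨_, r, rfl⟩
        exact ⟨Multiplicative.ofAdd r, by ext; simp⟩
    exact ⟨MulEquiv.ofBijective _ hbij, by simp⟩
  obtain ⟨e, he⟩ := key a ha
  obtain ⟨f, hf⟩ := key b hb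
  refine ⟨e.symm.trans f, ?_⟩
  rw [MulEquiv.trans_apply, ← he, e.symm_apply_apply, hf]

/-- The model at level `0` is the infinite cyclic group generated by `t`. -/
theorem isModel_zero {k : ℕ} (w : Fin k → List (Fin k)) :
    IsModel w 0 (fun _ => 1) (Multiplicative.ofAdd (1 : ℤ))
      { carrier := {x | 0 < Multiplicative.toAdd x}
        mul_mem' := fun {x y} (hx : 0 < Multiplicative.toAdd x) (hy : 0 < Multiplicative.toAdd y) =>
          show 0 < Multiplicative.toAdd x + Multiplicative.toAdd y from add_pos hx hy } ⊥ where
  rel i hi := absurd hi (Nat.not_lt_zero _)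
  t_mem := show (0 : ℤ) < 1 from one_pos
  inv_mem i hi := absurd hi (Nat.not_lt_zero _)
  mul_mem i hi := absurd hi (Nat.not_lt_zero _)
  mul_ne_one i hi := absurd hi (Nat.not_lt_zero _)
  disjoint x hx h := by
    rw [Subgroup.mem_bot] at h
    subst h
    exact lt_irrefl (0 : ℤ) hx
  notMem i hi := absurd hi (Nat.not_lt_zero _)

/-- With `s = a_l t`, the relation `t⁻¹ a_l t = a_l w_l` reads `s⁻¹ t s = w_l⁻¹ t`. So the next
model is an HNN extension of the previous one, with stable letter `s⁻¹`. -/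
theorem IsModel.exists_succ {k : ℕ} {w : Fin k → List (Fin k)} (hw : ∀ i, ∀ j ∈ w i, j < i)
    {l : ℕ} (hl : l < k) {Q : Type} [Group Q] {a : Fin k → Q} {t : Q} {N : Subsemigroup Q}
    {K : Subgroup Q} (h : IsModel w l a t N K) :
    ∃ (Q' : Type) (_ : Group Q') (a' : Fin k → Q') (t' : Q') (N' : Subsemigroup Q')
      (K' : Subgroup Q'), IsModel w (l + 1) a' t' N' K' := by
  set L : Fin k := ⟨l, hl⟩
  set W : Q := ((w L).map a).prod with hW
  have hWN : w L ≠ [] → W⁻¹ ∈ N := inv_prod_mem fun j hj => h.inv_mem j (hw L j hj)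
  have hbN : W⁻¹ * t ∈ N := by
    by_cases hne : w L = []
    · simpa [hW, hne] using h.t_mem
    · exact N.mul_mem (hWN hne) h.t_mem
  have hord : ∀ c ∈ N, ∀ r : ℤ, c ^ r = 1 → r = 0 := fun c hc r hr =>
    zpow_eq_one_of_mem h.disjoint hc (hr ▸ K.one_mem)
  obtain ⟨φ, hφ⟩ := exists_zpowers_mulEquiv (hord t h.t_mem) (hord _ hbN)
  have hK : ∀ u : ℤˣ, ∀ x ∈ K, x ∈ HNNExtension.toSubgroup (Subgroup.zpowers t)
      (Subgroup.zpowers (W⁻¹ * t)) u → x = 1 := by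
    intro u x hx hxu
    rcases Int.units_eq_one_or u with rfl | rfl <;> obtain ⟨r, rfl⟩ := hxu
    · simp [zpow_eq_one_of_mem h.disjoint h.t_mem hx]
    · simp [zpow_eq_one_of_mem h.disjoint hbN hx]
  let E := HNNExtension Q (Subgroup.zpowers t) (Subgroup.zpowers (W⁻¹ * t)) φ
  let τ : E := HNNExtension.t
  let o : Q →* E := HNNExtension.of
  have hτ : τ * o t = o (W⁻¹ * t) * τ := by
    exact (HNNExtension.t_mul_of (φ := φ) ⟨t, Subgroup.mem_zpowers t⟩).trans
      (congrArg (fun x => o x * τ) hφ)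
  set K' : Subgroup E := Subgroup.closure (o '' (K : Set Q) ∪ {τ}) with hK'
  -- `a_l⁻¹ = t τ`, so it suffices to allow positive powers of `τ` after a first factor from `N`.
  let N' : Subsemigroup E :=
    { carrier := {y | ∃ x ∈ N, ∃ z ∈ Submonoid.closure (o '' (N : Set Q) ∪ {τ}), y = o x * z}
      mul_mem' := by
        rintro _ _ ⟨x, hx, z, hz, rfl⟩ ⟨x', hx', z', hz', rfl⟩
        exact ⟨x, hx, z * (o x' * z'), Submonoid.mul_mem _ hz
          (Submonoid.mul_mem _ (Submonoid.subset_closure (Or.inl ⟨x', hx', rfl⟩)) hz'), by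
            rw [mul_assoc]⟩ }
  have hoN : ∀ x ∈ N, o x ∈ N' := fun x hx => ⟨x, hx, 1, one_mem _, by simp⟩
  have hmemK : ∀ x, o x ∈ K' → x ∈ K := fun x hx =>
    HNNExtension.mem_of_of_mem_closure (φ := φ) hK hx
  let a' : Fin k → E := Function.update (fun i => o (a i)) L (τ⁻¹ * o t⁻¹)
  have ha' : ∀ i : Fin k, i.1 < l → a' i = o (a i) := fun i hi =>
    Function.update_of_ne (by rintro rfl; exact lt_irrefl _ hi) _ _
  have haL : a' L = τ⁻¹ * o t⁻¹ := Function.update_self _ _ _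
  have hprod : ∀ i : Fin k, i.1 < l + 1 → ((w i).map a').prod = o ((w i).map a).prod := by
    intro i hi
    rw [map_list_prod, List.map_map]
    congr 1
    refine List.map_congr_left fun j hj => ha' j ?_
    have := hw i j hj
    rw [Fin.lt_def] at this
    omega
  have hcase : ∀ {P : Fin k → Prop}, (∀ i : Fin k, i.1 < l → P i) → P L →
      ∀ i : Fin k, i.1 < l + 1 → P i := by
    intro P h1 h2 i hi
    rcases Nat.lt_succ_iff_lt_or_eq.1 hi with hi | hi
    · exact h1 i hi
    · rwa [show i = L from Fin.ext hi]
  have hsL : a' L * o t = τ⁻¹ := by rw [haL, map_inv]; group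
  refine ⟨E, inferInstance, a', o t, N', K', ?_, hoN t h.t_mem, ?_, ?_, ?_, ?_, ?_⟩
  · refine fun i hi => ?_
    rw [hprod i hi]
    revert i
    refine hcase (P := fun i => (o t)⁻¹ * a' i * o t = a' i * o ((w i).map a).prod)
      (fun i hi => ?_) ?_
    · rw [ha' i hi, ← map_inv, ← map_mul, ← map_mul, h.rel i hi, map_mul]
    · rw [haL, ← hW]
      have : τ * o t⁻¹ = o t⁻¹ * o W * τ := by
        rw [map_mul, map_inv] at hτ
        rw [map_inv, mul_inv_eq_iff_eq_mul, mul_assoc, hτ]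
        group
      have h2 : τ * (o t⁻¹) * τ⁻¹ = o t⁻¹ * o W := by rw [this]; group
      rw [mul_assoc τ⁻¹, ← h2, map_inv]
      group
  · refine hcase (fun i hi => ?_) ?_
    · rw [ha' i hi, ← map_inv]
      exact hoN _ (h.inv_mem i hi)
    · refine ⟨t, h.t_mem, τ, Submonoid.subset_closure (Or.inr rfl), ?_⟩
      rw [haL, map_inv]; group
  · refine hcase (fun i hi => ?_) ?_
    · rw [ha' i hi, ← map_mul]
      exact Subgroup.subset_closure (Or.inl ⟨_, h.mul_mem i hi, rfl⟩)
    · rw [hsL]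
      exact K'.inv_mem (Subgroup.subset_closure (Or.inr rfl))
  · refine hcase (fun i hi => ?_) ?_
    · rw [ha' i hi, ← map_mul, ← map_one o]
      exact (HNNExtension.of_injective φ).ne (h.mul_ne_one i hi)
    · rw [hsL, Ne, inv_eq_one]
      intro hτ1
      have : Multiplicative.ofAdd (1 : ℤ) = 1 := by
        rw [← HNNExtension.lift_t (φ := φ) (1 : Q →* Multiplicative ℤ) (Multiplicative.ofAdd 1)
          (by simp)]
        exact (congrArg _ hτ1).trans (map_one _)
      exact one_ne_zero (α := ℤ) (congrArg Multiplicative.toAdd this)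
  · rintro _ ⟨x, hx, z, hz, rfl⟩
    exact HNNExtension.of_mul_notMem_closure hφ h.t_mem hbN h.disjoint hK hz hx
  · refine hcase (fun i hi hne j hj => ?_) fun hne j hj => ?_
    · rw [ha' i hi, ha' j (lt_trans hj hi)]
      simp only [← map_mul, ← map_inv]
      exact fun hm => h.notMem i hi hne j hj (hmemK _ hm)
    · have hj' : j.1 < l := hj
      rw [hsL, ha' j hj', ← map_mul]
      intro hm
      -- The element is the reduced word `t τ (a_j t) τ⁻¹ t⁻¹`, as `a_j t` is not a power of `t`.
      have hred : a j * t ∉ Subgroup.zpowers t := by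
        rintro ⟨r, hr⟩
        simp only at hr
        have hr0 := zpow_eq_one_of_mem (r := r) h.disjoint h.t_mem (hr ▸ h.mul_mem j hj')
        exact h.mul_ne_one j hj' (by rw [← hr, hr0, zpow_zero])
      obtain ⟨x, hx, r, hr⟩ := HNNExtension.exists_head_inv_mul_mem_of_prod_mem_closure (φ := φ) hK
        (v := ⟨t, [(1, a j * t), (-1, t⁻¹)], by simpa using hred⟩) (u := 1)
        (by
          convert hm using 1
          simp only [HNNExtension.NormalWord.ReducedWord.prod]
          rw [inv_inv, mul_inv_rev]
          simp [o, τ, mul_assoc]) (by simp)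
      simp only at hr
      have hr' : x = t * (W⁻¹ * t) ^ r := by rw [hr]; group
      obtain ⟨m, rfl | rfl⟩ := r.eq_nat_or_neg
      · refine h.disjoint x ?_ hx
        rw [hr', zpow_natCast]
        clear hr hr' hx
        induction m with
        | zero => simpa using h.t_mem
        | succ m ih => rw [pow_succ, ← mul_assoc]; exact N.mul_mem ih hbN
      · cases m with
        | zero => exact h.disjoint x (by simpa [hr'] using h.t_mem) hx
        | succ m =>
          -- Here `x⁻¹ = (w⁻¹ t) ^ m * w⁻¹`, and `w⁻¹` lies in `N` because `w` is not empty.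
          refine h.disjoint x⁻¹ ?_ (K.inv_mem hx)
          have : x⁻¹ = (W⁻¹ * t) ^ m * W⁻¹ := by
            rw [hr', zpow_neg, zpow_natCast, pow_succ]; group
          rw [this]
          clear this hr hr' hx
          induction m with
          | zero => simpa using hWN hne
          | succ m ih => rw [pow_succ', mul_assoc]; exact N.mul_mem hbN ih

theorem exists_isModel {k : ℕ} {w : Fin k → List (Fin k)} (hw : ∀ i, ∀ j ∈ w i, j < i) {l : ℕ}
    (hl : l ≤ k) :
    ∃ (Q : Type) (_ : Group Q) (a : Fin k → Q) (t : Q) (N : Subsemigroup Q) (K : Subgroup Q),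
      IsModel w l a t N K := by
  induction l with
  | zero => exact ⟨_, _, _, _, _, _, isModel_zero w⟩
  | succ l ih =>
    obtain ⟨Q, _, a, t, N, K, h⟩ := ih (Nat.le_of_succ_le hl)
    exact h.exists_succ hw hl

end Hydra

/-! ### Subgroups of finite index -/

/-- Let `s`, `v`, `c` lie in a subgroup `K` of finite index, let `v` and `c` commute with `t`, and
let `s⁻¹ t s = t ^ n v⁻¹`. Right multiplication by `s` maps the coset `K t ^ m` to `K t ^ (n m)`, so
it permutes the finitely many cosets of this form. Hence `K t s⁻¹` is one of them, and `c` fixes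
each of them. -/
theorem Subgroup.conj_mem_of_finiteIndex {Q : Type*} [Group Q] {K : Subgroup Q} [K.FiniteIndex]
    {s t v c : Q} {n : ℤ} (hs : s ∈ K) (hv : v ∈ K) (hc : c ∈ K) (hvt : Commute v t)
    (hct : Commute c t) (hrel : s⁻¹ * t * s = t ^ n * v⁻¹) :
    (t * s⁻¹) * c * (t * s⁻¹)⁻¹ ∈ K := by
  obtain ⟨d, hd0, hd⟩ : ∃ d : ℤ, d ≠ 0 ∧ ∀ m : ℤ, t ^ m ∈ K ↔ d ∣ m := by
    have h : ∀ m : ℤ, t ^ m ∈ K ↔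
        (Function.minimalPeriod (t • ·) ((1 : Q) : Q ⧸ K) : ℤ) ∣ m := by
      intro m
      rw [← MulAction.zpow_smul_eq_iff_minimalPeriod_dvd, ← MulAction.mem_stabilizer_iff,
        MulAction.stabilizer_quotient]
    refine ⟨_, ?_, h⟩
    obtain ⟨m, hm, -, hmK⟩ := K.exists_pow_mem_of_index_ne_zero Subgroup.FiniteIndex.index_ne_zero t
    intro h0
    have := (h m).1 (by simpa using hmK)
    rw [h0, zero_dvd_iff] at this
    omega
  have hpow : ∀ m : ℤ, s⁻¹ * t ^ m * s = t ^ (n * m) * (v ^ m)⁻¹ := by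
    intro m
    have h1 : (s⁻¹ * t * s) ^ m = s⁻¹ * t ^ m * s := by
      have := conj_zpow (a := s⁻¹) (b := t) (i := m)
      rwa [inv_inv] at this
    rw [← h1, hrel, (hvt.symm.zpow_left n).inv_right.mul_zpow, zpow_mul, inv_zpow]
  have hdiv : ∀ m : ℤ, d ∣ n * m → d ∣ m := by
    intro m hm
    rw [← hd] at hm ⊢
    have h2 : s⁻¹ * t ^ m * s ∈ K := by
      rw [hpow]
      exact K.mul_mem hm (K.inv_mem (K.zpow_mem hv m))
    rwa [K.mul_mem_cancel_right hs, K.mul_mem_cancel_left (K.inv_mem hs)] at h2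
  have hcop : IsCoprime n d := by
    rw [Int.isCoprime_iff_gcd_eq_one]
    -- Apply `hdiv` to `m = d / gcd n d`.
    obtain ⟨m, hm⟩ := Int.gcd_dvd_right n d
    obtain ⟨n', hn'⟩ := Int.gcd_dvd_left n d
    have h1 : d ∣ n * m := ⟨n', by
      calc n * m = ((Int.gcd n d : ℤ) * n') * m := by rw [← hn']
        _ = ((Int.gcd n d : ℤ) * m) * n' := by ring
        _ = d * n' := by rw [← hm]⟩
    obtain ⟨q, hq⟩ := hdiv m h1
    have hm0 : d * ((Int.gcd n d : ℤ) * q) = d * 1 := by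
      calc d * ((Int.gcd n d : ℤ) * q) = (Int.gcd n d : ℤ) * (d * q) := by ring
        _ = d * 1 := by rw [← hq, ← hm, mul_one]
    have h3 := Int.eq_one_or_neg_one_of_mul_eq_one (mul_left_cancel₀ hd0 hm0)
    omega
  obtain ⟨e, f, hef⟩ := hcop
  have h1 : t * s⁻¹ = (t ^ (f * d) * v ^ e * s⁻¹) * t ^ e := by
    have h2 : t ^ (n * e) = v ^ e * (s⁻¹ * t ^ e * s) := by
      rw [hpow, ← mul_assoc, ((hvt.zpow_left e).zpow_right (n * e)).eq, mul_inv_cancel_right]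
    have h3 : t = t ^ (f * d) * t ^ (n * e) := by
      rw [← zpow_add, show f * d + n * e = 1 by linarith, zpow_one]
    calc t * s⁻¹ = t ^ (f * d) * t ^ (n * e) * s⁻¹ := by rw [← h3]
      _ = _ := by rw [h2]; group
  have hκ : t ^ (f * d) * v ^ e * s⁻¹ ∈ K :=
    K.mul_mem (K.mul_mem ((hd _).2 (dvd_mul_left d f)) (K.zpow_mem hv e)) (K.inv_mem hs)
  have h4 : t ^ e * c * (t ^ e)⁻¹ = c := by
    rw [← (hct.zpow_right e).eq, mul_inv_cancel_right]
  have h5 : (t * s⁻¹) * c * (t * s⁻¹)⁻¹ =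
      (t ^ (f * d) * v ^ e * s⁻¹) * (t ^ e * c * (t ^ e)⁻¹) * (t ^ (f * d) * v ^ e * s⁻¹)⁻¹ := by
    rw [h1]; simp only [mul_assoc, mul_inv_rev]
  rw [h5, h4]
  exact K.mul_mem (K.mul_mem hκ hc) (K.inv_mem hκ)

/-! ### Residually finite HNN extensions -/

/-- If `Γ = ⟨G, p | p h p⁻¹ = h, h ∈ H⟩` is residually finite, then `H` is separable: an element
`g ∉ H` does not commute with `p`, and a finite quotient of `Γ` in which this persists separates
`g` from `H`. -/
theorem isSeparableSubgroup_of_residuallyFinite_hnnExtension {G : Type*} [Group G] {H : Subgroup G}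
    (h : Group.ResiduallyFinite (HNNExtension G H H (MulEquiv.refl H))) :
    IsSeparableSubgroup H := by
  intro g hg
  let o : G →* HNNExtension G H H (MulEquiv.refl H) := HNNExtension.of
  let p : HNNExtension G H H (MulEquiv.refl H) := HNNExtension.t
  have hne : p * o g * p⁻¹ * (o g)⁻¹ ≠ 1 := by
    intro h1
    have h2 := HNNExtension.ReducedWord.toList_eq_nil_of_mem_of_range (MulEquiv.refl H)
      ⟨1, [(1, g), (-1, 1)], by simpa using hg⟩ ⟨g, by
        rw [mul_inv_eq_one] at h1
        simpa [HNNExtension.NormalWord.ReducedWord.prod, o, p, mul_assoc] using h1.symm⟩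
    exact absurd h2 (by simp)
  obtain ⟨M, hM⟩ := Group.exists_finiteIndexNormalSubgroup_notMem _ hne
  refine ⟨M.toSubgroup.comap o, inferInstance, (M.comap o).isFiniteIndex', ?_⟩
  rintro ⟨x, hx, hxg⟩
  -- The commutator of `p` and `o g` agrees modulo `M` with that of `p` and `o x`, which is trivial.
  refine hM ?_
  have hox : o (x⁻¹ * g) ∈ M.toSubgroup := QuotientGroup.eq.1 hxg
  have hpx : p * o x = o x * p := HNNExtension.t_mul_of (φ := MulEquiv.refl H) ⟨x, hx⟩
  have hq : QuotientGroup.mk' M.toSubgroup (o x) = QuotientGroup.mk' M.toSubgroup (o g) :=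
    QuotientGroup.eq.2 (by simpa using hox)
  change _ ∈ M.toSubgroup
  rw [← QuotientGroup.ker_mk' M.toSubgroup, MonoidHom.mem_ker]
  rw [map_mul, map_mul, map_mul, map_inv, map_inv, ← hq, ← map_inv, ← map_inv, ← map_mul, ← map_mul,
    ← map_mul, hpx]
  simp

/-! ### The groups `G_k(w)` -/

namespace Hydra

variable {k : ℕ} {w : Fin k → List (Fin k)}

theorem mk_wordElt (u : List (Fin k)) :
    PresentedGroup.mk (rels w) (wordElt u) = (u.map (genA w)).prod := by
  rw [wordElt, map_list_prod, List.map_map]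
  rfl

theorem inv_genT_mul_genA_mul_genT (i : Fin k) :
    (genT w)⁻¹ * genA w i * genT w = genA w i * ((w i).map (genA w)).prod := by
  have h := PresentedGroup.one_of_mem (rels := rels w) ⟨i, rfl⟩
  rw [map_mul, map_inv, mul_inv_eq_one] at h
  rw [← mk_wordElt]
  simp only [map_mul, map_inv] at h
  exact h

/-- The universal property of `G_k(w)`. -/
theorem exists_hom {Q : Type*} [Group Q] (a : Fin k → Q) (t : Q)
    (h : ∀ i, t⁻¹ * a i * t = a i * ((w i).map a).prod) :
    ∃ f : G w →* Q, (∀ i, f (genA w i) = a i) ∧ f (genT w) = t := by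
  let F : Gen k → Q := fun x => Gen.rec a t x
  have hF : ∀ r ∈ rels w, FreeGroup.lift F r = 1 := by
    rintro _ ⟨i, rfl⟩
    have : FreeGroup.lift F (wordElt (w i)) = ((w i).map a).prod := by
      rw [wordElt, map_list_prod, List.map_map]
      congr 1
      exact List.map_congr_left fun j _ => by simp [F]
    rw [map_mul, map_inv, mul_inv_eq_one, map_mul (FreeGroup.lift F) (FreeGroup.of _), this]
    simpa [F] using h i
  exact ⟨PresentedGroup.toGroup hF, fun i => PresentedGroup.toGroup.of hF,
    PresentedGroup.toGroup.of hF⟩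

theorem genA_mul_genT_mem (i : Fin k) : genA w i * genT w ∈ H w :=
  Subgroup.subset_closure ⟨i, rfl⟩

theorem commute_genA_genT {i : Fin k} (hi : w i = []) : Commute (genA w i) (genT w) := by
  have h := inv_genT_mul_genA_mul_genT (w := w) i
  rw [hi, List.map_nil, List.prod_nil, mul_one, mul_assoc, inv_mul_eq_iff_eq_mul] at h
  exact h

theorem commute_prod_and_prod_mul_pow_mem {u : List (Fin k)} (hu : ∀ j ∈ u, w j = []) :
    Commute (u.map (genA w)).prod (genT w) ∧
      (u.map (genA w)).prod * genT w ^ u.length ∈ H w := by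
  induction u with
  | nil => exact ⟨by simp, by simp⟩
  | cons j u ih =>
    obtain ⟨h1, h2⟩ := ih fun i hi => hu i (by simp [hi])
    have hj := commute_genA_genT (hu j (by simp))
    refine ⟨by simpa using hj.mul_left h1, ?_⟩
    have : ((j :: u).map (genA w)).prod * genT w ^ (j :: u).length =
        (genA w j * genT w) * ((u.map (genA w)).prod * genT w ^ u.length) := by
      rw [List.map_cons, List.prod_cons, List.length_cons, pow_succ', mul_assoc, mul_assoc,
        ← mul_assoc _ (genT w), h1.eq, mul_assoc]
    rw [this]
    exact (H w).mul_mem (genA_mul_genT_mem j) h2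

theorem eq_nil_of_isSeparableSubgroup (hw : ∀ i : Fin k, ∀ j ∈ w i, j < i)
    (hsep : IsSeparableSubgroup (H w)) (i : Fin k) : w i = [] := by
  -- By strong induction, `i` is the least index for which `w i` may be nonempty.
  induction i using WellFoundedLT.induction with
  | ind i ih =>
  by_contra hne
  obtain ⟨j, hj⟩ := List.exists_mem_of_ne_nil _ hne
  set s := genA w i * genT w
  set c := genA w j * genT w
  have hnot : (genT w * s⁻¹) * c * (genT w * s⁻¹)⁻¹ ∉ H w := by
    obtain ⟨Q, _, a, t, N, K, hQ⟩ := exists_isModel hw le_rfl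
    obtain ⟨f, hfa, hft⟩ := exists_hom a t fun i => hQ.rel i i.2
    have hle : H w ≤ K.comap f := by
      rw [H, Subgroup.closure_le]
      rintro _ ⟨i, rfl⟩
      simpa [hfa, hft] using hQ.mul_mem i i.2
    intro hmem
    refine hQ.notMem i i.2 hne j (hw i j hj) ?_
    simpa only [Subgroup.mem_comap, map_mul, map_inv, hfa, hft, s, c] using hle hmem
  obtain ⟨M, hMn, hMf, hM⟩ := hsep _ hnot
  set K := ((H w).map (QuotientGroup.mk' M)).comap (QuotientGroup.mk' M)
  have hMK : M ≤ K := by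
    intro x hx
    refine ⟨1, (H w).one_mem, ?_⟩
    rw [map_one]
    exact ((QuotientGroup.eq_one_iff x).2 hx).symm
  have hHK : H w ≤ K := Subgroup.le_comap_map _ _
  have : K.FiniteIndex := Subgroup.finiteIndex_of_le hMK
  obtain ⟨hW, hv⟩ := commute_prod_and_prod_mul_pow_mem fun j hj => ih j (hw i j hj)
  set W := ((w i).map (genA w)).prod with hWdef
  have hr : (genA w i)⁻¹ * genT w * genA w i = genT w * W⁻¹ := by
    have h := inv_genT_mul_genA_mul_genT (w := w) i
    rw [← hWdef] at h
    have h' : (genT w) * W⁻¹ * (genA w i)⁻¹ = (genA w i)⁻¹ * genT w := by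
      rw [mul_assoc, ← mul_inv_rev, ← h]; group
    rw [← h']; group
  refine hM (Subgroup.conj_mem_of_finiteIndex (K := K) (n := (w i).length + 1)
    (v := W * genT w ^ (w i).length) (hHK (genA_mul_genT_mem i)) (hHK hv)
    (hHK (genA_mul_genT_mem j)) (hW.mul_left (Commute.pow_self _ _))
    ((commute_genA_genT (ih j (hw i j hj))).mul_left (Commute.refl _)) ?_)
  calc s⁻¹ * genT w * s
      = (genT w)⁻¹ * ((genA w i)⁻¹ * genT w * genA w i) * genT w := by
        simp only [s, mul_inv_rev, mul_assoc]
    _ = W⁻¹ * genT w := by rw [hr]; group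
    _ = genT w * W⁻¹ := hW.inv_left.eq
    _ = _ := by
      rw [mul_inv_rev, ← mul_assoc, zpow_add, zpow_one, zpow_natCast, ← pow_succ, pow_succ',
        mul_inv_cancel_right]

theorem isSeparableSubgroup_of_eq_nil (h : ∀ i : Fin k, w i = []) :
    IsSeparableSubgroup (H w) := by
  -- `H` is the kernel of `ψ`.
  obtain ⟨ψ, hψa, hψt⟩ := exists_hom (w := w) (fun _ => Multiplicative.ofAdd (-1 : ℤ))
    (Multiplicative.ofAdd (1 : ℤ)) fun i => by rw [h i]; simp
  have hψH : ∀ x ∈ H w, ψ x = 1 := by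
    have : H w ≤ ψ.ker := by
      rw [H, Subgroup.closure_le]
      rintro _ ⟨i, rfl⟩
      rw [SetLike.mem_coe, MonoidHom.mem_ker, map_mul, hψa, hψt]
      rfl
    exact this
  have hcentral : genT w ∈ Subgroup.center (G w) := by
    have : (⊤ : Subgroup (G w)) ≤ Subgroup.centralizer {genT w} := by
      rw [← PresentedGroup.closure_range_of, Subgroup.closure_le]
      rintro _ ⟨x, rfl⟩
      rw [SetLike.mem_coe, Subgroup.mem_centralizer_singleton_iff]
      cases x with
      | a i => exact (commute_genA_genT (h i)).eq
      | t => rfl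
    rw [Subgroup.mem_center_iff]
    exact fun x => Subgroup.mem_centralizer_singleton_iff.1 (this (Subgroup.mem_top x))
  have hdecomp : ∀ x : G w, ∃ y ∈ H w, ∃ r : ℤ, x = y * genT w ^ r := by
    have hn : (Subgroup.zpowers (genT w)).Normal :=
      ⟨by
        rintro _ ⟨r, rfl⟩ g
        refine ⟨r, ?_⟩
        have := Subgroup.mem_center_iff.1 ((Subgroup.center (G w)).zpow_mem hcentral r) g
        simp only
        rw [this, mul_inv_cancel_right]⟩
    have htop : (⊤ : Subgroup (G w)) ≤ H w ⊔ Subgroup.zpowers (genT w) := by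
      rw [← PresentedGroup.closure_range_of, Subgroup.closure_le]
      rintro _ ⟨x, rfl⟩
      have ht : genT w ∈ H w ⊔ Subgroup.zpowers (genT w) :=
        Subgroup.mem_sup_right (Subgroup.mem_zpowers _)
      cases x with
      | a i =>
        exact (Subgroup.mul_mem_cancel_right _ ht).1
          (Subgroup.mem_sup_left (genA_mul_genT_mem i))
      | t => exact ht
    intro x
    obtain ⟨y, hy, _, ⟨r, rfl⟩, rfl⟩ :=
      Subgroup.mem_sup_of_normal_right.1 (htop (Subgroup.mem_top x))
    exact ⟨y, hy, r, rfl⟩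
  intro g hg
  obtain ⟨y, hy, r, rfl⟩ := hdecomp g
  have hr : r ≠ 0 := by
    rintro rfl
    exact hg (by simpa using hy)
  let q : G w →* Multiplicative (ZMod (r.natAbs + 1)) :=
    (AddMonoidHom.toMultiplicative (Int.castAddHom (ZMod (r.natAbs + 1)))).comp ψ
  refine ⟨q.ker, inferInstance, inferInstance, ?_⟩
  rintro ⟨x, hx, hxg⟩
  have h1 : q (x⁻¹ * (y * genT w ^ r)) = 1 := QuotientGroup.eq.1 hxg
  have h2 : ψ (x⁻¹ * (y * genT w ^ r)) = Multiplicative.ofAdd r := by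
    rw [map_mul, map_mul, map_inv, hψH x hx, hψH y hy, map_zpow, hψt]
    simp [← ofAdd_zsmul]
  have h3 : ((r : ℤ) : ZMod (r.natAbs + 1)) = 0 := by
    have h4 : q (x⁻¹ * (y * genT w ^ r)) = Multiplicative.ofAdd (r : ZMod (r.natAbs + 1)) :=
      congrArg (AddMonoidHom.toMultiplicative (Int.castAddHom (ZMod (r.natAbs + 1)))) h2
    exact congrArg Multiplicative.toAdd (h4.symm.trans h1)
  rw [ZMod.intCast_zmod_eq_zero_iff_dvd] at h3
  have := Int.natAbs_dvd_natAbs.2 h3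
  have := Nat.le_of_dvd (by omega) this
  omega

theorem exists_mulEquiv_of_eq_nil (h : ∀ i : Fin k, w i = []) :
    ∃ e : G w ≃* FreeGroup (Fin k) × Multiplicative ℤ,
      (∀ i : Fin k, e (genA w i) = (FreeGroup.of i, 1)) ∧
      e (genT w) = (1, Multiplicative.ofAdd 1) := by
  obtain ⟨f, hfa, hft⟩ := exists_hom (w := w)
    (fun i => ((FreeGroup.of i, 1) : FreeGroup (Fin k) × Multiplicative ℤ))
    (1, Multiplicative.ofAdd 1) fun i => by rw [h i]; simp
  have hcomm : ∀ (x : FreeGroup (Fin k)) (r : Multiplicative ℤ),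
      Commute (FreeGroup.lift (genA w) x) (zpowersHom (G w) (genT w) r) := by
    intro x r
    rw [zpowersHom_apply]
    refine Commute.zpow_right ?_ _
    induction x using FreeGroup.induction_on with
    | C1 => simp
    | of i => simpa using commute_genA_genT (h i)
    | inv_of i hi => simpa using hi
    | mul x y hx hy => rw [map_mul]; exact hx.mul_left hy
  let g := MonoidHom.noncommCoprod (FreeGroup.lift (genA w)) (zpowersHom (G w) (genT w)) hcomm
  refine ⟨MonoidHom.toMulEquiv f g ?_ ?_, hfa, hft⟩
  · refine PresentedGroup.ext fun x => ?_
    cases x with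
    | a i =>
      change g (f (genA w i)) = genA w i
      simp [hfa, g]
    | t =>
      change g (f (genT w)) = genT w
      simp [hft, g]
  · refine MonoidHom.ext fun ⟨x, r⟩ => ?_
    change f (g (x, r)) = (x, r)
    have h1 : f (FreeGroup.lift (genA w) x) = (x, 1) := by
      have : f.comp (FreeGroup.lift (genA w)) = MonoidHom.inl _ _ :=
        FreeGroup.ext_hom _ _ fun i => by simp [hfa]
      exact DFunLike.congr_fun this x
    rw [MonoidHom.noncommCoprod_apply, map_mul, h1, zpowersHom_apply, map_zpow, hft]
    simp [← ofAdd_zsmul]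

end Hydra

theorem theorem4 (k : ℕ) (w : Fin k → List (Fin k))
    (hw : ∀ i : Fin k, ∀ j ∈ w i, j < i) :
    (IsSeparableSubgroup (Hydra.H w) ↔ ∀ i : Fin k, w i = []) ∧
    (Group.ResiduallyFinite (Hydra.Gam w) →
      ∃ e : Hydra.G w ≃* FreeGroup (Fin k) × Multiplicative ℤ,
        (∀ i : Fin k, e (Hydra.genA w i) = (FreeGroup.of i, 1)) ∧
        e (Hydra.genT w) = (1, Multiplicative.ofAdd 1)) :=
  ⟨⟨Hydra.eq_nil_of_isSeparableSubgroup hw, Hydra.isSeparableSubgroup_of_eq_nil⟩, fun h =>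
    Hydra.exists_mulEquiv_of_eq_nil (Hydra.eq_nil_of_isSeparableSubgroup hw
      (isSeparableSubgroup_of_residuallyFinite_hnnExtension h))⟩
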